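/- Let $\mathbb{K}$ be an algebraically closed field of characteristic zero, $N$ a lattice of finite rank, $M=\mathrm{Hom}(N,\mathbb{Z})$, and $\sigma\subseteq N_{\mathbb{Q}}$ a strongly convex polyhedral cone. Put $S_\sigma=\{u\in M \mid \langle v,u\rangle\ge 0 \ \ \forall v\in\sigma\}$, let $\mathbb{K}[S_\sigma]=\bigoplus_{u\in S_\sigma}\mathbb{K}\chi^u$, and let $X_\sigma=\mathrm{Spec}\,\mathbb{K}[S_\sigma]$ be the corresponding affine toric variety, with acting torus $\mathbb{T}=\mathrm{Hom}(M,\mathbb{K}^\times)$. For a cone $\gamma$ write $\gamma^\perp$ for the set of $u$ with $\langle v,u\rangle=0$ for all $v\in\gamma$. A Demazure root of $\sigma$ is an element $e\in M$ such that $\langle q,e\rangle=-1$ for the primitive vector $q$ on one ray of $\sigma$ and $\langle q',e\rangle\ge 0$ for the primitive vectors $q'$ on all other rays. Let $\tau$ be a regular $k$-dimensional face of $\sigma$, i.e. the primitive vectors $p_1,\dots,p_k$ on its rays form part of a basis of $N$. Let $e_1^{(r)},e_2^{(r)}$ $(r=1,\dots,k)$ be Demazure roots of $\sigma$ compatible with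 $\tau$: $\langle p_s,e_1^{(r)}\rangle=\langle p_s,e_2^{(r)}\rangle=-\delta_{rs}$ for all $r,s$. Consider on $X_\sigma$ the root monoid structure $(x,y)\mapsto x*y$ given by the comultiplication $\mathbb{K}[S_\sigma]\to\mathbb{K}[S_\sigma]\otimes\mathbb{K}[S_\sigma]$, $$\chi^u\mapsto(\chi^u\otimes\chi^u)\prod_{r=1}^k\bigl(1\otimes\chi^{e_1^{(r)}}+\chi^{e_2^{(r)}}\otimes 1\bigr)^{\langle p_r,u\rangle}.$$ Let $\gamma$ be a face of $\sigma$, let $x_\gamma\in X_\sigma$ be the distinguished point with $\chi^u(x_\gamma)=1$ if $u\in\gamma^\perp$ and $\chi^u(x_\gamma)=0$ otherwise $(u\in S_\sigma)$, let $O_\gamma=\mathbb{T}x_\gamma$, and let $E_\gamma=\{x\in O_\gamma\mid x*x=x\}$. Then: 1. if $\tau\subseteq\gamma$, then $E_\gamma=\{x_\gamma\}$; 2. if there is an $r$ with $p_r\notin\gamma$ such that either $e_1^{(r)}\notin\gamma^\perp$ and $e_2^{(r)}\notin\gamma^\perp$, or $e_1^{(r)}\in\gamma^\perp$ and $e_2^{(r)}\in\gamma^\perp$,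 then $E_\gamma=\varnothing$; 3. if for every $r$ with $p_r\notin\gamma$ exactly one of $e_1^{(r)},e_2^{(r)}$ lies in $\gamma^\perp$, then $$E_\gamma=O_\gamma\cap\{x\in X_\sigma\mid \chi^u(x)=1\ \text{ for all } u\in\mathrm{cone}(\tau,\gamma)^\perp\cap S_\sigma\}.$$ -/

import Mathlib

open scoped TensorProduct

namespace RootMonoid

section Cones

variable {N : Type*} [AddCommGroup N]

/-- `N_ℚ = ℚ ⊗ N`. -/
abbrev NQ (N : Type*) [AddCommGroup N] : Type _ := ℚ ⊗[ℤ] N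

/-- The image of a lattice vector in `N_ℚ`. -/
def latt (n : N) : NQ N := (1 : ℚ) ⊗ₜ[ℤ] n

/-- The pairing `⟨v, u⟩` of `v ∈ N_ℚ` with `u ∈ M = Hom(N, ℤ)`, as a functional of `v`. -/
def pair (u : Module.Dual ℤ N) : NQ N →ₗ[ℚ] ℚ := Module.Dual.baseChange ℚ u

@[simp] lemma pair_latt (u : Module.Dual ℤ N) (n : N) : pair u (latt n) = (u n : ℚ) := by
  simp [pair, latt]

@[simp] lemma pair_add (u w : Module.Dual ℤ N) (v : NQ N) :
    pair (u + w) v = pair u v + pair w v := by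
  simp [pair, Module.Dual.baseChange, LinearMap.baseChange_add]

@[simp] lemma pair_zero (v : NQ N) : pair (0 : Module.Dual ℤ N) v = 0 := by
  simp [pair, Module.Dual.baseChange]

/-- The semigroup `S_σ = σ^∨ ∩ M`. -/
def S (σ : PointedCone ℚ (NQ N)) : AddSubmonoid (Module.Dual ℤ N) where
  carrier := {u | ∀ v ∈ σ, 0 ≤ pair u v}
  zero_mem' := fun v _ => by simp
  add_mem' := fun {a b} ha hb v hv => by
    rw [pair_add]; exact add_nonneg (ha v hv) (hb v hv)

/-- `γ^⊥ ∩ M`. -/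
def perp (γ : PointedCone ℚ (NQ N)) : Set (Module.Dual ℤ N) :=
  {u | ∀ v ∈ γ, pair u v = 0}

/-- `γ` is a face of `σ`: `γ = σ ∩ u^⊥` for some `u ∈ σ^∨ ∩ M`. -/
def IsFace (γ σ : PointedCone ℚ (NQ N)) : Prop :=
  ∃ u ∈ S σ, ∀ v, v ∈ γ ↔ v ∈ σ ∧ pair u v = 0

/-- A lattice vector is primitive if it is not a proper integer multiple of a lattice vector
(in particular it is nonzero). -/
def IsPrimitive (n : N) : Prop := ∀ (d : ℤ) (m : N), n = d • m → IsUnit d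

/-- `p` is the primitive vector on a one-dimensional face of `σ`. -/
def IsRayVector (σ : PointedCone ℚ (NQ N)) (p : N) : Prop :=
  IsPrimitive p ∧ IsFace (PointedCone.hull ℚ {latt p}) σ

end Cones

section Farkas
variable {V : Type*} [AddCommGroup V] [Module ℚ V]

lemma hull_induction_nonneg {T : Set V} {f : V →ₗ[ℚ] ℚ} (h : ∀ t ∈ T, 0 ≤ f t) {x : V}
    (hx : x ∈ PointedCone.hull ℚ T) : 0 ≤ f x := by
  induction hx using Submodule.span_induction with
  | mem x hx => exact h x hx
  | zero => simp
  | add x y _ _ hx hy => rw [map_add]; exact add_nonneg hx hy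
  | smul a x _ hx =>
    change 0 ≤ f ((a : ℚ) • x)
    rw [map_smul]; exact mul_nonneg a.2 hx

lemma farkas (n : ℕ) : ∀ (L : List V), L.length = n → ∀ x : V,
    x ∉ PointedCone.hull ℚ {v | v ∈ L} →
      ∃ f : V →ₗ[ℚ] ℚ, (∀ v ∈ L, 0 ≤ f v) ∧ f x < 0 := by
  induction n with
  | zero =>
    intro L hL x hx
    have hL' : L = [] := List.length_eq_zero_iff.mp hL
    subst hL'
    have hx0 : x ≠ 0 := by rintro rfl; exact hx (Submodule.zero_mem _)
    obtain ⟨f, hf⟩ : ∃ f : Module.Dual ℚ V, f x ≠ 0 := by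
      by_contra hcon
      push Not at hcon
      exact hx0 ((Module.forall_dual_apply_eq_zero_iff ℚ x).1 hcon)
    rcases lt_or_gt_of_ne hf with h | h
    · exact ⟨f, by simp, h⟩
    · exact ⟨-f, by simp, by simpa using h⟩
  | succ n ih =>
    intro L hL x hx
    match L, hL with
    | a :: L, hL =>
    have hset : {v | v ∈ a :: L} = insert a {v | v ∈ L} := by ext; simp
    rw [hset] at hx
    have hxL : x ∉ PointedCone.hull ℚ {v | v ∈ L} := fun h =>
      hx (Submodule.span_mono (Set.subset_insert _ _) h)
    obtain ⟨f, hf, hfx⟩ := ih L (by simpa using hL) x hxL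
    by_cases hfa : 0 ≤ f a
    · exact ⟨f, by simpa using ⟨hfa, hf⟩, hfx⟩
    push Not at hfa
    let π : V →ₗ[ℚ] V := LinearMap.id - (f.smulRight ((f a)⁻¹ • a))
    have hπ : ∀ v, π v = v - (f v / f a) • a := fun v => by
      simp [π, smul_smul, div_eq_mul_inv]
    have key : π x ∉ PointedCone.hull ℚ {v | v ∈ L.map π} := by
      intro hmem
      have himg : {v | v ∈ L.map π} = π '' {v | v ∈ L} := by ext; simp
      have : PointedCone.hull ℚ (π '' {v | v ∈ L}) =
          (PointedCone.hull ℚ {v | v ∈ L}).map π := by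
        exact (Submodule.map_span (π.restrictScalars _) _).symm
      rw [himg, this, PointedCone.mem_map] at hmem
      obtain ⟨y, hy, hyx⟩ := hmem
      rw [hπ, hπ] at hyx
      have hfy : 0 ≤ f y := hull_induction_nonneg hf hy
      have hc : 0 ≤ (f x - f y) / f a :=
        div_nonneg_of_nonpos (by linarith) hfa.le
      refine hx (Submodule.mem_span_insert.2 ⟨⟨_, hc⟩, y, hy, ?_⟩)
      change x = ((f x - f y) / f a) • a + y
      rw [sub_div, sub_smul]
      rw [sub_eq_sub_iff_add_eq_add] at hyx
      rw [sub_add_eq_add_sub, eq_sub_iff_add_eq, ← hyx, add_comm]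
    obtain ⟨g, hg, hgx⟩ := ih (L.map π) (by simpa using hL) _ key
    refine ⟨g ∘ₗ π, ?_, hgx⟩
    intro v hv
    rcases List.mem_cons.1 hv with rfl | hv
    · have : π v = 0 := by rw [hπ, div_self hfa.ne, one_smul, sub_self]
      simp [this]
    · exact hg _ (List.mem_map_of_mem hv)

end Farkas


section Rays

variable {N : Type*} [AddCommGroup N]

lemma latt_zsmul (d : ℤ) (n : N) : latt (d • n) = (d : ℚ) • latt n := by
  rw [latt, latt, TensorProduct.tmul_smul, ← Int.cast_smul_eq_zsmul ℚ]

lemma exists_latt_multiple (v : NQ N) : ∃ d : ℕ, 0 < d ∧ ∃ n : N, (d : ℚ) • v = latt n := by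
  induction v using TensorProduct.induction_on with
  | zero => exact ⟨1, one_pos, 0, by simp [latt]⟩
  | tmul q n =>
    refine ⟨q.den, q.den_pos, q.num • n, ?_⟩
    rw [latt_zsmul, latt, TensorProduct.smul_tmul', TensorProduct.smul_tmul', smul_eq_mul,
      smul_eq_mul, mul_one, mul_comm, Rat.mul_den_eq_num]
  | add x y hx hy =>
    obtain ⟨d, hd, n, hn⟩ := hx
    obtain ⟨e, he, m, hm⟩ := hy
    refine ⟨d * e, Nat.mul_pos hd he, (e : ℤ) • n + (d : ℤ) • m, ?_⟩
    have h : latt ((e : ℤ) • n + (d : ℤ) • m) = latt ((e : ℤ) • n) + latt ((d : ℤ) • m) :=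
      TensorProduct.tmul_add _ _ _
    rw [h, latt_zsmul, latt_zsmul, ← hn, ← hm, smul_smul, smul_smul, smul_add]
    push_cast
    rw [mul_comm (e : ℚ)]

lemma mem_hull_singleton {v x : NQ N} :
    x ∈ PointedCone.hull ℚ {v} ↔ ∃ c : ℚ, 0 ≤ c ∧ x = c • v := by
  rw [Submodule.mem_span_singleton]
  constructor
  · rintro ⟨a, rfl⟩; exact ⟨a, a.2, rfl⟩
  · rintro ⟨c, hc, rfl⟩; exact ⟨⟨c, hc⟩, rfl⟩

lemma hull_singleton_smul {c : ℚ} (hc : 0 < c) (v : NQ N) :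
    PointedCone.hull ℚ {c • v} = PointedCone.hull ℚ {v} := by
  ext x
  rw [mem_hull_singleton, mem_hull_singleton]
  constructor
  · rintro ⟨a, ha, rfl⟩
    exact ⟨a * c, by positivity, by rw [smul_smul]⟩
  · rintro ⟨a, ha, rfl⟩
    exact ⟨a / c, by positivity, by rw [smul_smul, div_mul_cancel₀ _ hc.ne']⟩

/-- A face of a face is a face. -/
lemma IsFace.trans {ρ τ σ : PointedCone ℚ (NQ N)} (hfg : σ.FG) (hρ : IsFace ρ τ)
    (hτ : IsFace τ σ) : IsFace ρ σ := by
  classical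
  obtain ⟨u, hu, hτu⟩ := hτ
  obtain ⟨w, hw, hρw⟩ := hρ
  obtain ⟨T, hT⟩ := hfg
  have hTσ : ∀ t ∈ T, t ∈ σ := fun t ht => hT ▸ Submodule.subset_span ht
  have hmul : ∀ (n : ℕ) (v : NQ N), pair (w + n • u) v = pair w v + n * pair u v := by
    intro n v
    induction n with
    | zero => simp
    | succ n ih => rw [succ_nsmul, ← add_assoc, pair_add, ih]; push_cast; ring
  obtain ⟨n, hn⟩ : ∃ n : ℕ, ∀ t ∈ T, 0 ≤ pair (w + n • u) t := by
    have h1 : ∀ t ∈ T, ∃ n : ℕ, 0 ≤ pair w t + n * pair u t := by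
      intro t ht
      rcases (hu t (hTσ t ht)).eq_or_lt with h | h
      · exact ⟨0, by simpa using hw t ((hτu t).2 ⟨hTσ t ht, h.symm⟩)⟩
      · obtain ⟨n, hn⟩ := exists_nat_ge (-(pair w t) / pair u t)
        refine ⟨n, ?_⟩
        rw [div_le_iff₀ h] at hn
        linarith
    choose! n hn using h1
    refine ⟨∑ t ∈ T, n t, fun t ht => ?_⟩
    rw [hmul]
    have h2 : (n t : ℚ) ≤ ((∑ t ∈ T, n t : ℕ) : ℚ) := by
      exact_mod_cast Finset.single_le_sum (f := n) (fun _ _ => Nat.zero_le _) ht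
    nlinarith [hn t ht, hu t (hTσ t ht)]
  have hS : w + n • u ∈ S σ := fun v hv => by
    rw [← hT] at hv
    exact hull_induction_nonneg (T := (T : Set (NQ N))) hn hv
  refine ⟨w + (n + 1) • u, ?_, fun v => ⟨fun hv => ?_, fun hv => ?_⟩⟩
  · rw [succ_nsmul, ← add_assoc]; exact add_mem hS hu
  · have h1 := (hρw v).1 hv
    have h2 := (hτu v).1 h1.1
    exact ⟨h2.1, by rw [hmul, h1.2, h2.2]; simp⟩
  · obtain ⟨hvσ, h0⟩ := hv
    rw [succ_nsmul, ← add_assoc, pair_add] at h0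
    have h1 := hS v hvσ
    have h2 := hu v hvσ
    have h3 : pair u v = 0 := by linarith
    have hvτ := (hτu v).2 ⟨hvσ, h3⟩
    refine (hρw v).2 ⟨hvτ, ?_⟩
    have h4 : pair (w + n • u) v = 0 := by linarith
    rw [hmul, h3] at h4; simpa using h4

variable [Module.Free ℤ N] [Module.Finite ℤ N]

lemma exists_pair_multiple (f : NQ N →ₗ[ℚ] ℚ) :
    ∃ d : ℚ, 0 < d ∧ ∃ u : Module.Dual ℤ N, ∀ v, pair u v = d * f v := by
  classical
  let b := Module.Free.chooseBasis ℤ N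
  obtain ⟨c, hc⟩ := IsLocalization.exist_integer_multiples_of_finite (nonZeroDivisors ℤ)
    (fun i => f (latt (b i)))
  choose z hz using hc
  have hc0 : ((c : ℤ) : ℚ) ≠ 0 := by
    exact_mod_cast nonZeroDivisors.coe_ne_zero c
  refine ⟨(c : ℤ) * (c : ℤ), mul_self_pos.2 hc0, b.constr ℤ (fun i => (c : ℤ) * z i), ?_⟩
  intro v
  have key : pair (b.constr ℤ (fun i => (c : ℤ) * z i)) = (((c : ℤ) * (c : ℤ) : ℚ)) • f := by
    refine (b.baseChange ℚ).ext fun i => ?_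
    rw [Module.Basis.baseChange_apply]
    change pair _ (latt (b i)) = _ * f (latt (b i))
    have h1 : ((z i : ℤ) : ℚ) = ((c : ℤ) : ℚ) * f (latt (b i)) := by
      have := hz i
      simpa [Algebra.smul_def, Submonoid.smul_def] using this
    rw [pair_latt, Module.Basis.constr_basis]
    push_cast
    rw [h1]; ring
  rw [key]; rfl

lemma exists_primitive (n : N) (hn : n ≠ 0) :
    ∃ c : ℕ, 0 < c ∧ ∃ p : N, IsPrimitive p ∧ n = (c : ℤ) • p := by
  classical
  let b := Module.Free.chooseBasis ℤ N
  obtain ⟨i, hi⟩ : ∃ i, b.repr n i ≠ 0 := by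
    by_contra hcon
    push Not at hcon
    exact hn (b.ext_elem fun i => by simpa using hcon i)
  clear hn
  induction hk : (b.repr n i).natAbs using Nat.strong_induction_on generalizing n with
  | _ k ih =>
    by_cases hp : IsPrimitive n
    · exact ⟨1, one_pos, n, hp, by simp⟩
    · simp only [IsPrimitive, not_forall] at hp
      obtain ⟨d, m, rfl, hd⟩ := hp
      have hrep : b.repr (d • m) i = d * b.repr m i := by simp
      rw [hrep] at hi hk
      have hd0 : d ≠ 0 := left_ne_zero_of_mul hi
      have hm0 := right_ne_zero_of_mul hi
      have hd2 : 1 < d.natAbs := by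
        rw [Int.isUnit_iff_natAbs_eq] at hd
        have := Int.natAbs_pos.2 hd0
        omega
      have hlt : (b.repr (d.sign • m) i).natAbs < k := by
        have h1 : (b.repr (d.sign • m) i).natAbs = (b.repr m i).natAbs := by
          have : b.repr (d.sign • m) i = d.sign * b.repr m i := by simp
          rw [this, Int.natAbs_mul, Int.natAbs_sign_of_ne_zero hd0, one_mul]
        rw [h1, ← hk, Int.natAbs_mul]
        have := Int.natAbs_pos.2 hm0
        nlinarith
      have hne : b.repr (d.sign • m) i ≠ 0 := by
        have : b.repr (d.sign • m) i = d.sign * b.repr m i := by simp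
        rw [this]
        exact mul_ne_zero (by simpa using hd0) hm0
      obtain ⟨c, hc, p, hp, hmp⟩ := ih _ hlt (d.sign • m) hne rfl
      refine ⟨d.natAbs * c, Nat.mul_pos (by omega) hc, p, hp, ?_⟩
      rw [Nat.cast_mul, mul_smul, ← hmp, smul_smul, mul_comm, Int.sign_mul_natAbs]

/-- A strongly convex polyhedral cone is generated by the primitive vectors on its rays. -/
lemma eq_hull_rays {σ : PointedCone ℚ (NQ N)} (hfg : σ.FG)
    (hsal : ∀ v ∈ σ, -v ∈ σ → v = 0) :
    σ = PointedCone.hull ℚ {v | ∃ q, IsRayVector σ q ∧ v = latt q} := by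
  classical
  let P : ℕ → Prop := fun n => ∃ T : Finset (NQ N), T.card = n ∧ PointedCone.hull ℚ ↑T = σ
  have hP : ∃ n, P n := by
    obtain ⟨T, hT⟩ := hfg
    exact ⟨_, T, rfl, hT⟩
  obtain ⟨T, hTc, hT⟩ := Nat.find_spec hP
  have hmin : ∀ T' : Finset (NQ N), PointedCone.hull ℚ ↑T' = σ → T.card ≤ T'.card := by
    intro T' h; rw [hTc]; exact Nat.find_min' hP ⟨T', rfl, h⟩
  have hTσ : ∀ t ∈ T, t ∈ σ := fun t ht => hT ▸ Submodule.subset_span ht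
  -- no generator is redundant
  have hred : ∀ s ∈ T, s ∉ PointedCone.hull ℚ (↑(T.erase s) : Set (NQ N)) := by
    intro s hs hmem
    have h1 : PointedCone.hull ℚ (↑(T.erase s) : Set (NQ N)) = σ := by
      apply le_antisymm
      · rw [← hT]; exact Submodule.span_mono (by simp)
      · rw [← hT]
        refine Submodule.span_le.2 fun t ht => ?_
        by_cases hts : t = s
        · subst hts; exact hmem
        · exact Submodule.subset_span (by simp [hts]; exact ht)
    have := hmin _ h1
    rw [Finset.card_erase_of_mem hs] at this
    have := Finset.card_pos.2 ⟨s, hs⟩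
    omega
  have hne : ∀ s ∈ T, s ≠ 0 := by
    rintro s hs rfl; exact hred 0 hs (Submodule.zero_mem _)
  -- separating one generator from another
  have hsep : ∀ s ∈ T, ∀ t ∈ T, t ≠ s → ∃ f : NQ N →ₗ[ℚ] ℚ,
      (∀ v ∈ T, 0 ≤ f v) ∧ f s = 0 ∧ 0 < f t := by
    intro s hs t ht hts
    have hnot : -t ∉ PointedCone.hull ℚ {v | v ∈ (-s) :: T.toList} := by
      intro hmem
      have hset : {v | v ∈ (-s) :: T.toList} = insert (-s) (T : Set (NQ N)) := by
        ext; simp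
      rw [hset, Submodule.mem_span_insert] at hmem
      obtain ⟨a, z, hz, hza⟩ := hmem
      have hTs : (T : Set (NQ N)) = insert s (↑(T.erase s) : Set (NQ N)) := by
        rw [← Finset.coe_insert, Finset.insert_erase hs]
      have hzσ : z ∈ σ := hT ▸ hz
      rw [hTs, Submodule.mem_span_insert] at hz
      obtain ⟨b, w, hw, rfl⟩ := hz
      have hwσ : w ∈ σ := by
        rw [← hT]; exact Submodule.span_mono (by simp) hw
      have htE : t ∈ PointedCone.hull ℚ (↑(T.erase s) : Set (NQ N)) :=
        Submodule.subset_span (by simp [hts]; exact ht)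
      have heq : ((a : ℚ) - b) • s = w + t := by
        have : -t = -((a : ℚ) • s) + ((b : ℚ) • s + w) := by
          rw [hza]; change (a : ℚ) • -s + _ = _; rw [smul_neg]; rfl
        have h2 : t = (a : ℚ) • s - ((b : ℚ) • s + w) := by
          rw [← neg_neg t, this]; abel
        rw [h2, sub_smul]; abel
      rcases lt_or_ge (b : ℚ) a with hab | hab
      · apply hred s hs
        have hpos : 0 < (a : ℚ) - b := by linarith
        have : s = ((a : ℚ) - b)⁻¹ • (w + t) := by
          rw [← heq, smul_smul, inv_mul_cancel₀ hpos.ne', one_smul]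
        have hmem := PointedCone.smul_mem _ (inv_nonneg.2 hpos.le) (Submodule.add_mem _ hw htE)
        rwa [← this] at hmem
      · apply hne t ht
        refine hsal t (hTσ t ht) ?_
        have : -t = w + ((b : ℚ) - a) • s := by
          have h3 : ((b : ℚ) - a) • s = -(w + t) := by
            rw [← heq, ← neg_smul, neg_sub]
          rw [h3]; abel
        rw [this]
        exact Submodule.add_mem _ hwσ (PointedCone.smul_mem _ (by linarith) (hTσ s hs))
    obtain ⟨f, hf, hft⟩ := farkas _ _ rfl _ hnot
    have hfT : ∀ v ∈ T, 0 ≤ f v := fun v hv => hf v (by simp [hv])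
    refine ⟨f, hfT, le_antisymm ?_ (hfT s hs), by simpa using hft⟩
    simpa using hf (-s) (by simp)
  apply le_antisymm
  · rw [← hT, Submodule.span_le, hT]
    intro s hs
    -- a functional cutting out the ray of `s`
    choose! f hf using hsep s hs
    obtain ⟨d, hd, u, hu⟩ := exists_pair_multiple (∑ t ∈ T.erase s, f t)
    have hg : ∀ v ∈ T, 0 ≤ (∑ t ∈ T.erase s, f t) v := by
      intro v hv
      rw [LinearMap.sum_apply]
      exact Finset.sum_nonneg fun t ht =>
        (hf t (Finset.mem_of_mem_erase ht) (Finset.ne_of_mem_erase ht)).1 v hv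
    have hgs : (∑ t ∈ T.erase s, f t) s = 0 := by
      rw [LinearMap.sum_apply]
      exact Finset.sum_eq_zero fun t ht =>
        (hf t (Finset.mem_of_mem_erase ht) (Finset.ne_of_mem_erase ht)).2.1
    have hgpos : ∀ v ∈ T.erase s, 0 < (∑ t ∈ T.erase s, f t) v := by
      intro v hv
      rw [LinearMap.sum_apply]
      refine Finset.sum_pos' (fun t ht => ?_) ⟨v, hv, ?_⟩
      · exact (hf t (Finset.mem_of_mem_erase ht) (Finset.ne_of_mem_erase ht)).1 v
          (Finset.mem_of_mem_erase hv)
      · exact (hf v (Finset.mem_of_mem_erase hv) (Finset.ne_of_mem_erase hv)).2.2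
    set g := ∑ t ∈ T.erase s, f t with hgdef
    have hface : IsFace (PointedCone.hull ℚ {s}) σ := by
      refine ⟨u, fun v hv => ?_, fun v => ⟨fun hv => ?_, fun hv => ?_⟩⟩
      · rw [hu]
        exact mul_nonneg hd.le (hull_induction_nonneg hg (hT.symm ▸ hv))
      · obtain ⟨c, hc, rfl⟩ := mem_hull_singleton.1 hv
        exact ⟨PointedCone.smul_mem _ hc (hTσ s hs), by rw [hu, map_smul, hgs]; simp⟩
      · obtain ⟨hvσ, hv0⟩ := hv
        have hgv : g v = 0 := by
          rw [hu] at hv0; exact (mul_eq_zero.1 hv0).resolve_left hd.ne'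
        have hTs : (T : Set (NQ N)) = insert s (↑(T.erase s) : Set (NQ N)) := by
          rw [← Finset.coe_insert, Finset.insert_erase hs]
        rw [← hT, hTs, Submodule.mem_span_insert] at hvσ
        obtain ⟨b, w, hw, rfl⟩ := hvσ
        have hgw : g w = 0 := by
          have : g (b • s + w) = (b : ℚ) * g s + g w := by
            change g ((b : ℚ) • s + w) = _
            rw [map_add, map_smul, smul_eq_mul]
          rw [this, hgs] at hgv; simpa using hgv
        have hw0 : 0 ≤ g w ∧ (g w = 0 → w = 0) := by
          clear hgw hv0 hgv
          induction hw using Submodule.span_induction with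
          | mem x hx =>
            have := hgpos x hx
            exact ⟨this.le, fun h => absurd h this.ne'⟩
          | zero => simp
          | add x y _ _ hx hy =>
            rw [map_add]
            refine ⟨add_nonneg hx.1 hy.1, fun h => ?_⟩
            rw [hx.2 (by linarith [hx.1, hy.1]), hy.2 (by linarith [hx.1, hy.1]), add_zero]
          | smul a x _ hx =>
            change 0 ≤ g ((a : ℚ) • x) ∧ (g ((a : ℚ) • x) = 0 → (a : ℚ) • x = 0)
            rw [map_smul, smul_eq_mul]
            refine ⟨mul_nonneg a.2 hx.1, fun h => ?_⟩
            rcases mul_eq_zero.1 h with h | h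
            · rw [h, zero_smul]
            · rw [hx.2 h, smul_zero]
        rw [hw0.2 hgw, add_zero]
        exact Submodule.smul_mem _ _ (Submodule.subset_span rfl)
    obtain ⟨e, he, n, hn⟩ := exists_latt_multiple s
    have heQ : (0 : ℚ) < e := by exact_mod_cast he
    have hn0 : n ≠ 0 := by
      rintro rfl
      have h0 : latt (0 : N) = 0 := TensorProduct.tmul_zero _ _
      rw [h0] at hn
      exact hne s hs ((smul_eq_zero.1 hn).resolve_left heQ.ne')
    obtain ⟨c, hc, p, hp, rfl⟩ := exists_primitive n hn0
    have hcQ : (0 : ℚ) < c := by exact_mod_cast hc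
    have hsp : s = ((e : ℚ)⁻¹ * c) • latt p := by
      rw [latt_zsmul] at hn
      rw [mul_smul, ← Int.cast_natCast c, ← hn, smul_smul, inv_mul_cancel₀ heQ.ne', one_smul]
    have hray : IsRayVector σ p := by
      refine ⟨hp, ?_⟩
      rw [hsp, hull_singleton_smul (by positivity)] at hface
      exact hface
    rw [hsp]
    exact PointedCone.smul_mem _ (by positivity) (Submodule.subset_span ⟨p, hray, rfl⟩)
  · refine Submodule.span_le.2 ?_
    rintro _ ⟨q, ⟨_, u, _, hq⟩, rfl⟩
    exact ((hq _).1 (Submodule.subset_span rfl)).1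

/-- Membership in `S_σ` can be tested on the primitive vectors of the rays. -/
lemma mem_S_iff {σ : PointedCone ℚ (NQ N)} (hfg : σ.FG)
    (hsal : ∀ v ∈ σ, -v ∈ σ → v = 0) {u : Module.Dual ℤ N} :
    u ∈ S σ ↔ ∀ q, IsRayVector σ q → 0 ≤ u q := by
  constructor
  · rintro hu q ⟨_, w, _, hq⟩
    have := hu (latt q) ((hq _).1 (Submodule.subset_span rfl)).1
    rw [pair_latt] at this
    exact_mod_cast this
  · intro h v hv
    rw [eq_hull_rays hfg hsal] at hv
    refine hull_induction_nonneg ?_ hv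
    rintro _ ⟨q, hq, rfl⟩
    rw [pair_latt]
    exact_mod_cast h q hq

end Rays


section Toric

variable {N : Type*} [AddCommGroup N]

/-- `e` is a Demazure root of `σ`: it pairs to `-1` with the primitive vector on one ray and
nonnegatively with the primitive vectors on all other rays. -/
def IsDemazureRoot (σ : PointedCone ℚ (NQ N)) (e : Module.Dual ℤ N) : Prop :=
  ∃ q, IsRayVector σ q ∧ e q = -1 ∧ ∀ q', IsRayVector σ q' → q' ≠ q → 0 ≤ e q'

/-- The combinatorial data of a root monoid: a strongly convex polyhedral cone `σ`, a regular
`k`-dimensional face `τ` of `σ` with the primitive vectors `p r` on its rays, and Demazure roots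
`e₁ r`, `e₂ r` of `σ` compatible with `τ`. -/
structure RootDatum (N : Type*) [AddCommGroup N] (k : ℕ) where
  /-- the cone of the toric variety -/
  σ : PointedCone ℚ (NQ N)
  fg : σ.FG
  salient : (σ : ConvexCone ℚ (NQ N)).Salient
  /-- the regular face -/
  τ : PointedCone ℚ (NQ N)
  face : IsFace τ σ
  /-- the primitive vectors on the rays of `τ`, listed without repetition -/
  p : Fin k → N
  p_injective : Function.Injective p
  range_p : Set.range p = {q | IsRayVector τ q}
  /-- the primitive vectors on the rays of `τ` form a part of a basis of the lattice -/
  regular : ∃ (b : Module.Basis (Fin (Module.finrank ℤ N)) ℤ N)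
    (f : Fin k → Fin (Module.finrank ℤ N)), ∀ r, b (f r) = p r
  /-- the first roots of the pairs -/
  e₁ : Fin k → Module.Dual ℤ N
  /-- the second roots of the pairs -/
  e₂ : Fin k → Module.Dual ℤ N
  root₁ : ∀ r, IsDemazureRoot σ (e₁ r)
  root₂ : ∀ r, IsDemazureRoot σ (e₂ r)
  compat₁ : ∀ r s, e₁ r (p s) = if r = s then -1 else 0
  compat₂ : ∀ r s, e₂ r (p s) = if r = s then -1 else 0

/-- The algebra `K[X_σ] = K[S_σ]` of regular functions on the affine toric variety `X_σ`. -/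
abbrev CoordRing (K : Type*) [Field K] (σ : PointedCone ℚ (NQ N)) : Type _ :=
  AddMonoidAlgebra K (S σ)

/-- The algebra `K[M]` of regular functions on the torus; it contains `K[X_σ]`. -/
abbrev TorusRing (K : Type*) [Field K] (N : Type*) [AddCommGroup N] : Type _ :=
  AddMonoidAlgebra K (Module.Dual ℤ N)

/-- The points of `X_σ`, as `K`-algebra homomorphisms `K[X_σ] → K`. -/
abbrev Pt (K : Type*) [Field K] (σ : PointedCone ℚ (NQ N)) : Type _ :=
  CoordRing K σ →ₐ[K] K

/-- The function `χ^u` on `X_σ`, for `u ∈ S_σ`. -/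
noncomputable def chi (K : Type*) [Field K] {σ : PointedCone ℚ (NQ N)} (u : S σ) :
    CoordRing K σ :=
  AddMonoidAlgebra.single u 1

/-- The character `χ^u` of the torus, for `u ∈ M`. -/
noncomputable def chiT (K : Type*) [Field K] (u : Module.Dual ℤ N) : TorusRing K N :=
  AddMonoidAlgebra.single u 1

/-- The inclusion `K[X_σ] ⊆ K[M]`. -/
noncomputable def incl (K : Type*) [Field K] (σ : PointedCone ℚ (NQ N)) :
    CoordRing K σ →ₐ[K] TorusRing K N :=
  AddMonoidAlgebra.mapDomainAlgHom K K (S σ).subtype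

/-- The inclusion `K[X_σ] ⊗ K[X_σ] ⊆ K[M] ⊗ K[M]`. -/
noncomputable def incl₂ (K : Type*) [Field K] (σ : PointedCone ℚ (NQ N)) :
    CoordRing K σ ⊗[K] CoordRing K σ →ₐ[K] TorusRing K N ⊗[K] TorusRing K N :=
  Algebra.TensorProduct.map (incl K σ) (incl K σ)

lemma incl_chi (K : Type*) [Field K] {σ : PointedCone ℚ (NQ N)} (u : S σ) :
    incl K σ (chi K u) = chiT K (u : Module.Dual ℤ N) := by
  simp [incl, chi, chiT]

lemma incl₂_injective (K : Type*) [Field K] (σ : PointedCone ℚ (NQ N)) :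
    Function.Injective (incl₂ K σ) := by
  have h : Function.Injective (incl K σ) :=
    AddMonoidAlgebra.mapDomain_injective Subtype.val_injective
  exact TensorProduct.map_injective_of_flat_flat (incl K σ).toLinearMap (incl K σ).toLinearMap h h

lemma chiT_add (K : Type*) [Field K] (u w : Module.Dual ℤ N) :
    chiT K (u + w) = chiT K u * chiT K w := by
  simp [chiT, AddMonoidAlgebra.single_mul_single]

lemma chiT_zero (K : Type*) [Field K] : chiT K (0 : Module.Dual ℤ N) = 1 := rfl

lemma chi_add (K : Type*) [Field K] {σ : PointedCone ℚ (NQ N)} (u w : S σ) :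
    chi K (u + w) = chi K u * chi K w := by
  simp [chi, AddMonoidAlgebra.single_mul_single]

lemma chi_zero (K : Type*) [Field K] {σ : PointedCone ℚ (NQ N)} : chi K (0 : S σ) = 1 := rfl

namespace RootDatum

variable {k : ℕ}

lemma p_ray (D : RootDatum N k) (r : Fin k) : IsRayVector D.σ (D.p r) := by
  have h : IsRayVector D.τ (D.p r) := by
    have : D.p r ∈ Set.range D.p := ⟨r, rfl⟩
    rw [D.range_p] at this; exact this
  exact ⟨h.1, h.2.trans D.fg D.face⟩

lemma pair_p_nonneg (D : RootDatum N k) (u : S D.σ) (r : Fin k) :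
    0 ≤ (u : Module.Dual ℤ N) (D.p r) := by
  obtain ⟨_, w, _, hq⟩ := D.p_ray r
  have := u.2 (latt (D.p r)) ((hq _).1 (Submodule.subset_span rfl)).1
  rw [pair_latt] at this
  exact_mod_cast this

/-- The element `1 ⊗ χ^{e₁} + χ^{e₂} ⊗ 1` of `K[M] ⊗ K[M]` for the `r`-th pair of roots. -/
noncomputable def factor (K : Type*) [Field K] (D : RootDatum N k) (r : Fin k) :
    TorusRing K N ⊗[K] TorusRing K N :=
  1 ⊗ₜ chiT K (D.e₁ r) + chiT K (D.e₂ r) ⊗ₜ 1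

/-- The homomorphism `K[X_σ] → K[M] ⊗ K[M]` with
`χ^u ↦ (χ^u ⊗ χ^u) ∏ r, (1 ⊗ χ^{e₁ r} + χ^{e₂ r} ⊗ 1) ^ ⟨p r, u⟩`.
The exponents are nonnegative by `pair_p_nonneg`. -/
noncomputable def comultM (K : Type*) [Field K] (D : RootDatum N k) :
    CoordRing K D.σ →ₐ[K] TorusRing K N ⊗[K] TorusRing K N :=
  AddMonoidAlgebra.lift K (TorusRing K N ⊗[K] TorusRing K N) (S D.σ)
    { toFun := fun u =>
        (chiT K (u.toAdd : Module.Dual ℤ N) ⊗ₜ chiT K (u.toAdd : Module.Dual ℤ N)) *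
          ∏ r, D.factor K r ^ ((u.toAdd : Module.Dual ℤ N) (D.p r)).toNat
      map_one' := by
        simp [chiT_zero, Algebra.TensorProduct.one_def]
      map_mul' := fun u w => by
        have h : ∀ r, (((u * w).toAdd : S D.σ) : Module.Dual ℤ N) (D.p r) =
            (u.toAdd : Module.Dual ℤ N) (D.p r) + (w.toAdd : Module.Dual ℤ N) (D.p r) :=
          fun r => rfl
        have h2 : (((u * w).toAdd : S D.σ) : Module.Dual ℤ N) =
          (u.toAdd : Module.Dual ℤ N) + (w.toAdd : Module.Dual ℤ N) := rfl
        have h3 : ∀ r, ((((u * w).toAdd : S D.σ) : Module.Dual ℤ N) (D.p r)).toNat =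
            ((u.toAdd : Module.Dual ℤ N) (D.p r)).toNat +
              ((w.toAdd : Module.Dual ℤ N) (D.p r)).toNat := fun r => by
          rw [h, Int.toNat_add (D.pair_p_nonneg _ _) (D.pair_p_nonneg _ _)]
        simp only [h3, pow_add, Finset.prod_mul_distrib]
        rw [h2, chiT_add, ← Algebra.TensorProduct.tmul_mul_tmul]
        ring }

lemma comultM_chi (K : Type*) [Field K] (D : RootDatum N k) (u : S D.σ) :
    D.comultM K (chi K u) =
      (chiT K (u : Module.Dual ℤ N) ⊗ₜ chiT K (u : Module.Dual ℤ N)) *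
        ∏ r, D.factor K r ^ ((u : Module.Dual ℤ N) (D.p r)).toNat := by
  simp [comultM, chi]

lemma chiT_nsmul (K : Type*) [Field K] (n : ℕ) (u : Module.Dual ℤ N) :
    chiT K (n • u) = chiT K u ^ n := by
  induction n with
  | zero => simp [chiT_zero]
  | succ n ih => rw [succ_nsmul, chiT_add, ih, pow_succ]

lemma chiT_sum (K : Type*) [Field K] {ι : Type*} (s : Finset ι) (u : ι → Module.Dual ℤ N) :
    chiT K (∑ i ∈ s, u i) = ∏ i ∈ s, chiT K (u i) := by
  classical
  induction s using Finset.induction_on with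
  | empty => simp [chiT_zero]
  | insert a s ha ih => rw [Finset.sum_insert ha, Finset.prod_insert ha, chiT_add, ih]

section

variable [Module.Free ℤ N] [Module.Finite ℤ N]

/-- If `i r ≤ ⟨p r, u⟩` for all `r`, then `u + ∑ r, i r • e r ∈ S_σ`, where `e` is `e₁` or `e₂`. -/
lemma add_sum_mem (D : RootDatum N k) {e : Fin k → Module.Dual ℤ N}
    (hroot : ∀ r, IsDemazureRoot D.σ (e r))
    (hcompat : ∀ r s, e r (D.p s) = if r = s then -1 else 0) (u : S D.σ) (i : Fin k → ℕ)
    (hi : ∀ r, i r ≤ ((u : Module.Dual ℤ N) (D.p r)).toNat) :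
    (u : Module.Dual ℤ N) + ∑ r, i r • e r ∈ S D.σ := by
  have hsal : ∀ v ∈ D.σ, -v ∈ D.σ → v = 0 := fun v hv hv' => by
    by_contra h; exact D.salient v hv h hv'
  rw [mem_S_iff D.fg hsal]
  intro q hq
  have hexp : ((u : Module.Dual ℤ N) + ∑ r, i r • e r) q =
      (u : Module.Dual ℤ N) q + ∑ r, (i r : ℤ) * e r q := by
    simp
  rw [hexp]
  by_cases hqp : ∃ s, q = D.p s
  · obtain ⟨s, rfl⟩ := hqp
    have h1 : ∑ r, (i r : ℤ) * e r (D.p s) = -(i s : ℤ) := by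
      simp [hcompat]
    have := hi s
    have := D.pair_p_nonneg u s
    omega
  · have h1 : ∀ r, 0 ≤ e r q := by
      intro r
      obtain ⟨q₀, _, hq₀, hpos⟩ := hroot r
      have hr : D.p r = q₀ := by
        by_contra hne
        have := hpos _ (D.p_ray r) hne
        rw [hcompat] at this
        simp at this
      exact hpos q hq fun h => hqp ⟨r, h.trans hr.symm⟩
    have h2 : 0 ≤ (u : Module.Dual ℤ N) q := ((mem_S_iff D.fg hsal).1 u.2) q hq
    exact add_nonneg h2 (Finset.sum_nonneg fun r _ => mul_nonneg (by positivity) (h1 r))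

/-- The image of `comultM` lies in `K[X_σ] ⊗ K[X_σ]`. -/
lemma comultM_mem (K : Type*) [Field K] (D : RootDatum N k) (f : CoordRing K D.σ) :
    D.comultM K f ∈ (incl₂ K D.σ).range := by
  classical
  have hchi : ∀ u : S D.σ, D.comultM K (chi K u) ∈ (incl₂ K D.σ).range := by
    intro u
    rw [comultM_chi]
    simp only [factor, add_pow]
    rw [Finset.prod_univ_sum, Finset.mul_sum]
    refine Subalgebra.sum_mem _ fun i hi => ?_
    have hi' : ∀ r, i r ≤ ((u : Module.Dual ℤ N) (D.p r)).toNat := fun r => by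
      have := Fintype.mem_piFinset.1 hi r
      rw [Finset.mem_range] at this; omega
    let n : Fin k → ℕ := fun r => ((u : Module.Dual ℤ N) (D.p r)).toNat
    let a : S D.σ := ⟨_, D.add_sum_mem D.root₂ D.compat₂ u (fun r => n r - i r)
      (fun r => Nat.sub_le _ _)⟩
    let b : S D.σ := ⟨_, D.add_sum_mem D.root₁ D.compat₁ u i hi'⟩
    refine ⟨(∏ r, (n r).choose (i r) : ℕ) • (chi K a ⊗ₜ[K] chi K b), ?_⟩
    change incl₂ K D.σ _ = _
    rw [map_nsmul, incl₂, Algebra.TensorProduct.map_tmul, incl_chi, incl_chi]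
    simp only [a, b, chiT_add, chiT_sum, chiT_nsmul, Algebra.TensorProduct.tmul_pow, one_pow,
      Algebra.TensorProduct.tmul_mul_tmul, one_mul, mul_one, Finset.prod_mul_distrib, n,
      nsmul_eq_mul, Nat.cast_prod]
    have hprod : ∀ (g h : Fin k → TorusRing K N),
        ∏ r, (g r ⊗ₜ[K] h r) = (∏ r, g r) ⊗ₜ[K] (∏ r, h r) := by
      intro g h
      have : ∀ s : Finset (Fin k), ∏ r ∈ s, (g r ⊗ₜ[K] h r) =
          (∏ r ∈ s, g r) ⊗ₜ[K] (∏ r ∈ s, h r) := by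
        intro s
        induction s using Finset.induction_on with
        | empty => simp [Algebra.TensorProduct.one_def]
        | insert c s hc ih =>
          rw [Finset.prod_insert hc, Finset.prod_insert hc, Finset.prod_insert hc, ih,
            Algebra.TensorProduct.tmul_mul_tmul]
      exact this _
    rw [hprod, ← Algebra.TensorProduct.tmul_mul_tmul]
    ring
  induction f using AddMonoidAlgebra.induction_on with
  | of u => exact hchi u
  | add f g hf hg => rw [map_add]; exact add_mem hf hg
  | smul c f hf => rw [map_smul]; exact Subalgebra.smul_mem _ hf c

/-- The comultiplication `K[X_σ] → K[X_σ] ⊗ K[X_σ]` of the root monoid. -/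
noncomputable def comult (K : Type*) [Field K] (D : RootDatum N k) :
    CoordRing K D.σ →ₐ[K] CoordRing K D.σ ⊗[K] CoordRing K D.σ :=
  ((AlgEquiv.ofInjective (incl₂ K D.σ) (incl₂_injective K D.σ)).symm : _ →ₐ[K] _).comp
    ((D.comultM K).codRestrict (incl₂ K D.σ).range (D.comultM_mem K))

/-- The comultiplication is given on `χ^u` by the defining formula, read in `K[M] ⊗ K[M]`. -/
lemma incl₂_comult_chi (K : Type*) [Field K] (D : RootDatum N k) (u : S D.σ) :
    incl₂ K D.σ (D.comult K (chi K u)) =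
      (chiT K (u : Module.Dual ℤ N) ⊗ₜ chiT K (u : Module.Dual ℤ N)) *
        ∏ r, D.factor K r ^ ((u : Module.Dual ℤ N) (D.p r)).toNat := by
  rw [← comultM_chi]
  have h := (AlgEquiv.ofInjective (incl₂ K D.σ) (incl₂_injective K D.σ)).apply_symm_apply
    ((D.comultM K).codRestrict (incl₂ K D.σ).range (D.comultM_mem K) (chi K u))
  exact congrArg Subtype.val h

/-- The multiplication `x * y` on the points of the root monoid: the image of the point `(x, y)`
of `X_σ × X_σ` under the morphism dual to the comultiplication. -/
noncomputable def mul (K : Type*) [Field K] (D : RootDatum N k) (x y : Pt K D.σ) : Pt K D.σ :=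
  (Algebra.TensorProduct.lift x y (fun _ _ => Commute.all _ _)).comp (D.comult K)

end

end RootDatum

open Classical in
/-- The distinguished point `x_γ` of a face `γ` of `σ`: `χ^u` is `1` at `x_γ` if `u ∈ γ^⊥` and
`0` otherwise. -/
noncomputable def distinguishedPoint (K : Type*) [Field K] {σ γ : PointedCone ℚ (NQ N)}
    (hγ : IsFace γ σ) : Pt K σ :=
  AddMonoidAlgebra.lift K K (S σ)
    { toFun := fun u => if (u.toAdd : Module.Dual ℤ N) ∈ perp γ then 1 else 0
      map_one' := if_pos fun v _ => pair_zero v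
      map_mul' := fun u w => by
        have hle : ∀ v ∈ γ, v ∈ σ := fun v hv => by
          obtain ⟨_, _, h⟩ := hγ; exact ((h v).1 hv).1
        have key : (((u * w).toAdd : S σ) : Module.Dual ℤ N) ∈ perp γ ↔
            (u.toAdd : Module.Dual ℤ N) ∈ perp γ ∧ (w.toAdd : Module.Dual ℤ N) ∈ perp γ := by
          have hsum : (((u * w).toAdd : S σ) : Module.Dual ℤ N) =
            (u.toAdd : Module.Dual ℤ N) + (w.toAdd : Module.Dual ℤ N) := rfl
          rw [hsum]
          constructor
          · intro h
            refine ⟨fun v hv => ?_, fun v hv => ?_⟩ <;>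
            · have h0 := h v hv
              rw [pair_add] at h0
              have h1 := u.toAdd.2 v (hle v hv)
              have h2 := w.toAdd.2 v (hle v hv)
              linarith
          · rintro ⟨h1, h2⟩ v hv
            rw [pair_add, h1 v hv, h2 v hv, add_zero]
        by_cases h1 : (u.toAdd : Module.Dual ℤ N) ∈ perp γ <;>
          by_cases h2 : (w.toAdd : Module.Dual ℤ N) ∈ perp γ <;>
          simp only [key, h1, h2] <;> simp }

/-- The action of the torus `Hom(M, Kˣ)` on `X_σ`: `χ^u(t x) = t(u) χ^u(x)`. -/
noncomputable def torusAct {K : Type*} [Field K] {σ : PointedCone ℚ (NQ N)}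
    (t : Multiplicative (Module.Dual ℤ N) →* Kˣ) (x : Pt K σ) : Pt K σ :=
  AddMonoidAlgebra.lift K K (S σ)
    { toFun := fun u =>
        (t (Multiplicative.ofAdd (u.toAdd : Module.Dual ℤ N)) : K) * x (chi K u.toAdd)
      map_one' := by
        simp [chi_zero]
      map_mul' := fun u w => by
        have h : t (Multiplicative.ofAdd ((u * w).toAdd : Module.Dual ℤ N)) =
            t (Multiplicative.ofAdd (u.toAdd : Module.Dual ℤ N)) *
              t (Multiplicative.ofAdd (w.toAdd : Module.Dual ℤ N)) := map_mul t _ _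
        rw [h, toAdd_mul, chi_add, map_mul, Units.val_mul]
        ring }

/-- The torus orbit `O_γ` of the distinguished point `x_γ`. -/
def orbit (K : Type*) [Field K] {σ γ : PointedCone ℚ (NQ N)} (hγ : IsFace γ σ) : Set (Pt K σ) :=
  Set.range fun t : Multiplicative (Module.Dual ℤ N) →* Kˣ =>
    torusAct t (distinguishedPoint K hγ)

/-- The set `E_γ` of idempotents of the root monoid that lie in the orbit `O_γ`. -/
def idempotents (K : Type*) [Field K] [Module.Free ℤ N] [Module.Finite ℤ N] {k : ℕ}
    (D : RootDatum N k) {γ : PointedCone ℚ (NQ N)} (hγ : IsFace γ D.σ) : Set (Pt K D.σ) :=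
  {x | x ∈ orbit K hγ ∧ D.mul K x x = x}

end Toric

end RootMonoid

/-! A point `x = t · x_γ` of `O_γ` is described by one function on `M`: it equals `t` on `γ^⊥` and
`0` elsewhere (`perpChar`). Because `γ^⊥` is a face of the dual cone `γ^∨`, this function, written
`c` here, is multiplicative on all of `S γ`, which is larger than `S σ`. The gain is that roots can
be evaluated: if `p_r ∉ γ`, the only ray on which `e₁ r` and `e₂ r` are negative is missing from
`γ`, so both lie in `S γ`.

Expanding the comultiplication binomially and evaluating at `(x, x)` gives `χ^u(x * x) = c(u)² ∏
(c(e₁ r) + c(e₂ r)) ^ ⟨p_r, u⟩` (`mul_self_chi`). If some `p_r ∈ γ` has `⟨p_r, u⟩ > 0`, both sides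
vanish. Cancelling `c(u)`, a unit on `γ^⊥`, shows that `x` is idempotent if and only if `c(u) ∏
(c(e₁ r) + c(e₂ r)) ^ ⟨p_r, u⟩ = 1` for all `u ∈ S_σ ∩ γ^⊥` (`mul_self_eq_iff`). The three claims
are read off from this criterion.

If `τ ⊆ γ`, all exponents vanish on `γ^⊥`, so `c = 1` on `S_σ ∩ γ^⊥`. Now let `p_r ∉ γ`. If neither
root of the pair is in `γ^⊥`, its factor is `0`, and a form `u` cutting out `γ` has positive
exponent there: a contradiction. If both are, comparing the criterion at `u` and at `u + e₁ r` gives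
`c(e₁ r) = c(e₁ r) + c(e₂ r)` (`perpChar_root_eq`), which is absurd because `c(e₂ r)` is a unit. If
exactly one root `e r` of each such pair is in `γ^⊥`, the criterion at `u` says `c(w) = 1` for `w =
u + ∑ ⟨p_r, u⟩ e r`, and `w` is orthogonal to both `τ` and `γ`. Conversely, for `u` orthogonal to
`τ` and `γ` the criterion is just `c(u) = 1`. -/

namespace RootMonoid

/-! ### Faces and their rays. -/

section Faces

variable {N : Type*} [AddCommGroup N]

/-- The pairing with a fixed vector of `N_ℚ`, as a homomorphism on `M`. -/
noncomputable def pairHom (v : NQ N) : Module.Dual ℤ N →+ ℚ where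
  toFun u := pair u v
  map_zero' := pair_zero v
  map_add' u w := pair_add u w v

lemma pair_add_sum {k : ℕ} (u : Module.Dual ℤ N) (i : Fin k → ℕ) (e : Fin k → Module.Dual ℤ N)
    (v : NQ N) : pair (u + ∑ r, i r • e r) v = pair u v + ∑ r, (i r : ℚ) * pair (e r) v := by
  change pairHom v _ = pairHom v u + ∑ r, (i r : ℚ) * pairHom v (e r)
  simp

/-- A face is a subset of the cone. -/
lemma IsFace.le {γ σ : PointedCone ℚ (NQ N)} (h : IsFace γ σ) : γ ≤ σ := fun v hv => by
  obtain ⟨_, _, h⟩ := h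
  exact ((h v).1 hv).1

/-- A face of `σ` that lies in a face `τ` of `σ` is a face of `τ`. -/
lemma IsFace.of_le {ρ τ σ : PointedCone ℚ (NQ N)} (hρ : IsFace ρ σ) (hτ : τ ≤ σ) (h : ρ ≤ τ) :
    IsFace ρ τ := by
  obtain ⟨w, hw, hρw⟩ := hρ
  exact ⟨w, fun v hv => hw v (hτ hv), fun v =>
    ⟨fun hv => ⟨h hv, ((hρw v).1 hv).2⟩, fun hv => (hρw v).2 ⟨hτ hv.1, hv.2⟩⟩⟩

lemma IsRayVector.latt_mem {σ : PointedCone ℚ (NQ N)} {q : N} (h : IsRayVector σ q) :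
    latt q ∈ σ :=
  h.2.le (Submodule.subset_span rfl)

variable [Module.Free ℤ N] [Module.Finite ℤ N]

/-- A face is generated by the primitive vectors of the rays of the cone that it contains. -/
lemma IsFace.le_hull_rays {γ σ : PointedCone ℚ (NQ N)} (hγ : IsFace γ σ) (hfg : σ.FG)
    (hsal : ∀ v ∈ σ, -v ∈ σ → v = 0) :
    γ ≤ PointedCone.hull ℚ {v | ∃ q, IsRayVector σ q ∧ latt q ∈ γ ∧ v = latt q} := by
  have hle := hγ.le
  obtain ⟨u, hu, hγu⟩ := hγ
  -- Nonnegativity has to be carried through the induction: a sum of nonnegative values is zero only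
  -- if each summand is, so only generators in `γ` contribute.
  have key : ∀ v ∈ PointedCone.hull ℚ {v | ∃ q, IsRayVector σ q ∧ v = latt q},
      0 ≤ pair u v ∧ (pair u v = 0 →
        v ∈ PointedCone.hull ℚ {v | ∃ q, IsRayVector σ q ∧ latt q ∈ γ ∧ v = latt q}) := by
    intro v hv
    induction hv using Submodule.span_induction with
    | mem x hx =>
      obtain ⟨q, hq, rfl⟩ := hx
      exact ⟨hu _ hq.latt_mem, fun h0 =>
        Submodule.subset_span ⟨q, hq, (hγu _).2 ⟨hq.latt_mem, h0⟩, rfl⟩⟩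
    | zero => exact ⟨by simp, fun _ => Submodule.zero_mem _⟩
    | add x y _ _ hx hy =>
      rw [map_add]
      exact ⟨add_nonneg hx.1 hy.1, fun h => Submodule.add_mem _
        (hx.2 (by linarith [hx.1, hy.1])) (hy.2 (by linarith [hx.1, hy.1]))⟩
    | smul a x _ hx =>
      change 0 ≤ pair u ((a : ℚ) • x) ∧ (pair u ((a : ℚ) • x) = 0 → (a : ℚ) • x ∈ _)
      rw [map_smul, smul_eq_mul]
      refine ⟨mul_nonneg a.2 hx.1, fun h => ?_⟩
      rcases mul_eq_zero.1 h with h | h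
      · rw [h, zero_smul]; exact Submodule.zero_mem _
      · exact PointedCone.smul_mem _ a.2 (hx.2 h)
  intro v hv
  have hvσ := hle hv
  rw [eq_hull_rays hfg hsal] at hvσ
  exact (key v hvσ).2 ((hγu v).1 hv).2

end Faces

/-! ### Compatible roots on faces, and the binomial expansion of the comultiplication. -/

lemma prod_tmul {A B K ι : Type*} [CommSemiring K] [CommSemiring A] [CommSemiring B] [Algebra K A]
    [Algebra K B] (s : Finset ι) (g : ι → A) (h : ι → B) :
    ∏ r ∈ s, (g r ⊗ₜ[K] h r) = (∏ r ∈ s, g r) ⊗ₜ[K] (∏ r ∈ s, h r) := by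
  classical
  induction s using Finset.induction_on with
  | empty => simp [Algebra.TensorProduct.one_def]
  | insert c s hc ih =>
    rw [Finset.prod_insert hc, Finset.prod_insert hc, Finset.prod_insert hc, ih,
      Algebra.TensorProduct.tmul_mul_tmul]

namespace RootDatum

variable {N : Type*} [AddCommGroup N] {k : ℕ} (D : RootDatum N k)

lemma neg_mem_imp_eq_zero : ∀ v ∈ D.σ, -v ∈ D.σ → v = 0 := fun v hv hv' => by
  by_contra h; exact D.salient v hv h hv'

lemma apply_p_eq_zero {γ : PointedCone ℚ (NQ N)} {u : Module.Dual ℤ N} (hu : u ∈ perp γ) {r : Fin k}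
    (hr : latt (D.p r) ∈ γ) : u (D.p r) = 0 := by
  have := hu _ hr
  rw [pair_latt] at this
  exact_mod_cast this

/-- A form that cuts out a face is positive on the rays outside the face. -/
lemma apply_p_pos {u : Module.Dual ℤ N} (hu : u ∈ S D.σ) {γ : PointedCone ℚ (NQ N)}
    (hγu : ∀ v, v ∈ γ ↔ v ∈ D.σ ∧ pair u v = 0) {r : Fin k} (hr : latt (D.p r) ∉ γ) :
    0 < u (D.p r) := by
  refine lt_of_le_of_ne (D.pair_p_nonneg ⟨u, hu⟩ r) fun h0 => hr ?_
  exact (hγu _).2 ⟨(D.p_ray r).latt_mem, by simp [← h0]⟩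

/-- A root that is compatible with `τ` is nonnegative on all rays but that of `p r`. -/
lemma root_nonneg {e : Fin k → Module.Dual ℤ N} (hroot : ∀ r, IsDemazureRoot D.σ (e r))
    (hcompat : ∀ r s, e r (D.p s) = if r = s then -1 else 0) {r : Fin k} {q : N}
    (hq : IsRayVector D.σ q) (hne : q ≠ D.p r) : 0 ≤ e r q := by
  obtain ⟨q₀, _, _, hpos⟩ := hroot r
  have hr : D.p r = q₀ := by
    by_contra hne
    have := hpos _ (D.p_ray r) hne
    rw [hcompat] at this
    simp at this
  exact hpos q hq (hr ▸ hne)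

variable [Module.Free ℤ N] [Module.Finite ℤ N]

/-- A compatible root is nonnegative on the faces that do not contain its distinguished ray. -/
lemma root_mem_S {e : Fin k → Module.Dual ℤ N} (hroot : ∀ r, IsDemazureRoot D.σ (e r))
    (hcompat : ∀ r s, e r (D.p s) = if r = s then -1 else 0) {γ : PointedCone ℚ (NQ N)}
    (hγ : IsFace γ D.σ) {r : Fin k} (hr : latt (D.p r) ∉ γ) : e r ∈ S γ := by
  intro v hv
  refine hull_induction_nonneg ?_ (hγ.le_hull_rays D.fg D.neg_mem_imp_eq_zero hv)
  rintro _ ⟨q, hq, hqγ, rfl⟩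
  rw [pair_latt]
  exact_mod_cast D.root_nonneg hroot hcompat hq fun h => hr (h ▸ hqγ)

/-- A form that vanishes at all `p r` vanishes on `τ`. -/
lemma mem_perp_τ {u : Module.Dual ℤ N} (hu : ∀ r, u (D.p r) = 0) : u ∈ perp D.τ := by
  have hrays : ∀ v ∈ {v | ∃ q, IsRayVector D.σ q ∧ latt q ∈ D.τ ∧ v = latt q}, pair u v = 0 := by
    rintro _ ⟨q, hq, hqτ, rfl⟩
    have hqr : q ∈ Set.range D.p := by
      rw [D.range_p]
      exact ⟨hq.1, hq.2.of_le D.face.le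
        (Submodule.span_le.2 (Set.singleton_subset_iff.2 hqτ))⟩
    obtain ⟨r, rfl⟩ := hqr
    simp [hu r]
  intro v hv
  have hv' := D.face.le_hull_rays D.fg D.neg_mem_imp_eq_zero hv
  -- Vanishing on the generators is used as two inequalities, one for `pair u` and one for `-pair
  -- u`.
  refine le_antisymm ?_ (hull_induction_nonneg (fun t ht => (hrays t ht).ge) hv')
  have := hull_induction_nonneg (f := -pair u) (fun t ht => by simp [hrays t ht]) hv'
  simpa using this

/-- The first exponents in the expansion of the comultiplication of `χ^u`. -/
def leftExp (u : S D.σ) (i : Fin k → ℕ) : S D.σ :=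
  ⟨_, D.add_sum_mem D.root₂ D.compat₂ u
    (fun r => ((u : Module.Dual ℤ N) (D.p r)).toNat - i r) fun _ => Nat.sub_le _ _⟩

/-- The second exponents in the expansion of the comultiplication of `χ^u`. -/
def rightExp (u : S D.σ) (i : Fin k → ℕ) : S D.σ :=
  ⟨_, D.add_sum_mem D.root₁ D.compat₁ u
    -- The `min` puts the element in `S σ` for every `i`; it equals `i r` on the index range of the
    -- expansion. Here `i r` counts the factors `1 ⊗ χ^{e₁ r}`, and the remaining ones, `χ^{e₂ r} ⊗
    -- 1`, go to `leftExp`.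
    (fun r => min (i r) ((u : Module.Dual ℤ N) (D.p r)).toNat) fun _ => min_le_right _ _⟩

/-- The binomial expansion of the comultiplication. -/
lemma comult_chi (K : Type*) [Field K] (u : S D.σ) :
    D.comult K (chi K u) =
      ∑ i ∈ Fintype.piFinset fun r => Finset.range (((u : Module.Dual ℤ N) (D.p r)).toNat + 1),
        (∏ r, (((u : Module.Dual ℤ N) (D.p r)).toNat).choose (i r)) •
          (chi K (D.leftExp u i) ⊗ₜ[K] chi K (D.rightExp u i)) := by
  classical
  -- The roots are not in `S σ`, so the factors can be expanded only in `K[M] ⊗ K[M]`.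
  apply incl₂_injective K D.σ
  rw [incl₂_comult_chi, map_sum]
  simp only [factor, add_pow]
  rw [Finset.prod_univ_sum, Finset.mul_sum]
  refine Finset.sum_congr rfl fun i hi => ?_
  have hi' : ∀ r, min (i r) ((u : Module.Dual ℤ N) (D.p r)).toNat = i r := fun r => by
    have := Fintype.mem_piFinset.1 hi r
    rw [Finset.mem_range] at this; omega
  rw [map_nsmul, incl₂, Algebra.TensorProduct.map_tmul, incl_chi, incl_chi]
  simp only [leftExp, rightExp, hi', chiT_add, chiT_sum, chiT_nsmul,
    Algebra.TensorProduct.tmul_pow, one_pow, Algebra.TensorProduct.tmul_mul_tmul, one_mul, mul_one,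
    Finset.prod_mul_distrib, nsmul_eq_mul, Nat.cast_prod]
  rw [prod_tmul, ← Algebra.TensorProduct.tmul_mul_tmul]
  ring

lemma mul_chi (K : Type*) [Field K] (x y : Pt K D.σ) (u : S D.σ) :
    D.mul K x y (chi K u) =
      ∑ i ∈ Fintype.piFinset fun r => Finset.range (((u : Module.Dual ℤ N) (D.p r)).toNat + 1),
        (∏ r, (((u : Module.Dual ℤ N) (D.p r)).toNat).choose (i r) : ℕ) *
          (x (chi K (D.leftExp u i)) * y (chi K (D.rightExp u i))) := by
  rw [mul, AlgHom.comp_apply, comult_chi, map_sum]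
  refine Finset.sum_congr rfl fun i _ => ?_
  rw [map_nsmul, nsmul_eq_mul, Algebra.TensorProduct.lift_tmul]

end RootDatum

/-! ### Points of an orbit as characters extended by zero. -/

section Orbits

variable {K : Type*} [Field K] {N : Type*} [AddCommGroup N]

lemma Pt.ext_chi {σ : PointedCone ℚ (NQ N)} {x y : Pt K σ}
    (h : ∀ u : S σ, x (chi K u) = y (chi K u)) : x = y :=
  AddMonoidAlgebra.algHom_ext h (Subsingleton.elim _ _)

open Classical in
lemma distinguishedPoint_chi {σ γ : PointedCone ℚ (NQ N)} (hγ : IsFace γ σ) (u : S σ) :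
    distinguishedPoint K hγ (chi K u) = if (u : Module.Dual ℤ N) ∈ perp γ then 1 else 0 := by
  simp [distinguishedPoint, chi]
  rfl

lemma torusAct_chi {σ : PointedCone ℚ (NQ N)} (t : Multiplicative (Module.Dual ℤ N) →* Kˣ)
    (x : Pt K σ) (u : S σ) :
    torusAct t x (chi K u) = (t (Multiplicative.ofAdd (u : Module.Dual ℤ N)) : K) * x (chi K u) := by
  simp [torusAct, chi]

open Classical in
/-- A character of the torus, restricted to `γ^⊥` and extended by zero. -/
noncomputable def perpChar (t : Multiplicative (Module.Dual ℤ N) →* Kˣ)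
    (γ : PointedCone ℚ (NQ N)) (a : Module.Dual ℤ N) : K :=
  if a ∈ perp γ then t (Multiplicative.ofAdd a) else 0

variable (t : Multiplicative (Module.Dual ℤ N) →* Kˣ) {γ : PointedCone ℚ (NQ N)}

lemma perpChar_of_mem {a : Module.Dual ℤ N} (ha : a ∈ perp γ) :
    perpChar t γ a = t (Multiplicative.ofAdd a) := if_pos ha

lemma perpChar_of_notMem {a : Module.Dual ℤ N} (ha : a ∉ perp γ) : perpChar t γ a = 0 := if_neg ha

lemma perpChar_ne_zero {a : Module.Dual ℤ N} (ha : a ∈ perp γ) : perpChar t γ a ≠ 0 := by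
  rw [perpChar_of_mem t ha]; exact Units.ne_zero _

/-- Replaces a point of `O_γ` by a function defined on all of `M`, which also has values at the
roots. -/
lemma torusAct_distinguishedPoint_chi {σ : PointedCone ℚ (NQ N)} (hγ : IsFace γ σ) (u : S σ) :
    torusAct t (distinguishedPoint K hγ) (chi K u) = perpChar t γ u := by
  rw [torusAct_chi, distinguishedPoint_chi, perpChar]
  split_ifs <;> simp

/-- A sum of elements of `S γ` is in `γ^⊥` if and only if the summands are. -/
lemma add_mem_perp_iff {a b : Module.Dual ℤ N} (ha : a ∈ S γ) (hb : b ∈ S γ) :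
    a + b ∈ perp γ ↔ a ∈ perp γ ∧ b ∈ perp γ := by
  constructor
  · intro h
    refine ⟨fun v hv => ?_, fun v hv => ?_⟩ <;>
    · have h0 := h v hv
      rw [pair_add] at h0
      have h1 := ha v hv
      have h2 := hb v hv
      linarith
  · rintro ⟨h1, h2⟩ v hv
    rw [pair_add, h1 v hv, h2 v hv, add_zero]

/-- On `S γ`, a character restricted to `γ^⊥` and extended by zero is multiplicative. -/
lemma perpChar_add {a b : Module.Dual ℤ N} (ha : a ∈ S γ) (hb : b ∈ S γ) :
    perpChar t γ (a + b) = perpChar t γ a * perpChar t γ b := by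
  have key := add_mem_perp_iff ha hb
  by_cases h1 : a ∈ perp γ
  · by_cases h2 : b ∈ perp γ
    · rw [perpChar_of_mem t h1, perpChar_of_mem t h2, perpChar_of_mem t (key.2 ⟨h1, h2⟩), ofAdd_add,
        map_mul, Units.val_mul]
    · rw [perpChar_of_notMem t h2, perpChar_of_notMem t fun h => h2 (key.1 h).2, mul_zero]
  · rw [perpChar_of_notMem t h1, perpChar_of_notMem t fun h => h1 (key.1 h).1, zero_mul]

lemma perpChar_zero : perpChar t γ (0 : Module.Dual ℤ N) = 1 := by
  rw [perpChar_of_mem t fun v _ => pair_zero v, ofAdd_zero, map_one, Units.val_one]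

lemma perpChar_nsmul {a : Module.Dual ℤ N} (ha : a ∈ S γ) (n : ℕ) :
    perpChar t γ (n • a) = perpChar t γ a ^ n := by
  induction n with
  | zero => rw [zero_smul, perpChar_zero, pow_zero]
  | succ n ih => rw [succ_nsmul, perpChar_add t (nsmul_mem ha n) ha, ih, pow_succ]

lemma perpChar_sum {ι : Type*} (s : Finset ι) {a : ι → Module.Dual ℤ N}
    (ha : ∀ i ∈ s, a i ∈ S γ) : perpChar t γ (∑ i ∈ s, a i) = ∏ i ∈ s, perpChar t γ (a i) := by
  classical
  induction s using Finset.induction_on with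
  | empty => simp [perpChar_zero]
  | insert c s hc ih =>
    have hs : ∀ i ∈ s, a i ∈ S γ := fun i hi => ha i (Finset.mem_insert_of_mem hi)
    rw [Finset.sum_insert hc, Finset.prod_insert hc,
      perpChar_add t (ha c (Finset.mem_insert_self _ _)) (sum_mem hs), ih hs]

end Orbits

/-! ### Squares of orbit points and the criterion for idempotency. -/

namespace RootDatum

variable {K : Type*} [Field K] {N : Type*} [AddCommGroup N] [Module.Free ℤ N] [Module.Finite ℤ N]
  {k : ℕ} (D : RootDatum N k) {γ : PointedCone ℚ (NQ N)} (hγ : IsFace γ D.σ)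
  (t : Multiplicative (Module.Dual ℤ N) →* Kˣ)

/-- For `p r ∈ γ` the root takes the value `-1` on `γ`, so only its zero multiple is harmless; this
is what `hi` guarantees. -/
lemma nsmul_root_mem_S {e : Fin k → Module.Dual ℤ N} (hroot : ∀ r, IsDemazureRoot D.σ (e r))
    (hcompat : ∀ r s, e r (D.p s) = if r = s then -1 else 0) (hγ : IsFace γ D.σ) {i : Fin k → ℕ}
    (hi : ∀ r, latt (D.p r) ∈ γ → i r = 0) (r : Fin k) : i r • e r ∈ S γ := by
  by_cases hr : latt (D.p r) ∈ γ
  · rw [hi r hr, zero_smul]; exact zero_mem _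
  · exact nsmul_mem (D.root_mem_S hroot hcompat hγ hr) _

/-- The family `e` is left general because the lemma serves `e₁`, `e₂` and the mixed choice made in
the third claim. -/
lemma perpChar_add_sum {e : Fin k → Module.Dual ℤ N} (hroot : ∀ r, IsDemazureRoot D.σ (e r))
    (hcompat : ∀ r s, e r (D.p s) = if r = s then -1 else 0) (hγ : IsFace γ D.σ) {i : Fin k → ℕ}
    (hi : ∀ r, latt (D.p r) ∈ γ → i r = 0) {u : Module.Dual ℤ N} (hu : u ∈ S γ) :
    perpChar t γ (u + ∑ r, i r • e r) = perpChar t γ u * ∏ r, perpChar t γ (e r) ^ i r := by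
  have hmem := D.nsmul_root_mem_S hroot hcompat hγ hi
  rw [perpChar_add t hu (sum_mem fun r _ => hmem r), perpChar_sum t _ fun r _ => hmem r]
  congr 1
  refine Finset.prod_congr rfl fun r _ => ?_
  by_cases hr : latt (D.p r) ∈ γ
  · rw [hi r hr, zero_smul, pow_zero, perpChar_zero]
  · rw [perpChar_nsmul t (D.root_mem_S hroot hcompat hγ hr)]

/-- The square of a point of the orbit `O_γ`. -/
lemma mul_self_chi (u : S D.σ) :
    D.mul K (torusAct t (distinguishedPoint K hγ)) (torusAct t (distinguishedPoint K hγ))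
        (chi K u) =
      perpChar t γ u * (perpChar t γ u *
        ∏ r, (perpChar t γ (D.e₁ r) + perpChar t γ (D.e₂ r)) ^
          ((u : Module.Dual ℤ N) (D.p r)).toNat) := by
  classical
  rw [mul_chi]
  simp only [torusAct_distinguishedPoint_chi]
  have huγ : (u : Module.Dual ℤ N) ∈ S γ := fun v hv => u.2 v (hγ.le hv)
  -- In the first case `perpChar` is multiplicative on all exponents that occur and the binomial
  -- theorem applies backwards; a factor with `p r ∈ γ` has exponent zero. In the second case both
  -- sides vanish, the left one term by term.
  by_cases hn : ∀ r, latt (D.p r) ∈ γ → ((u : Module.Dual ℤ N) (D.p r)).toNat = 0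
  · simp only [add_pow]
    rw [Finset.prod_univ_sum, Finset.mul_sum, Finset.mul_sum]
    refine Finset.sum_congr rfl fun i hi => ?_
    rw [leftExp, rightExp, D.perpChar_add_sum t D.root₂ D.compat₂ hγ _ huγ,
      D.perpChar_add_sum t D.root₁ D.compat₁ hγ _ huγ]
    · have hi' : ∀ r, min (i r) ((u : Module.Dual ℤ N) (D.p r)).toNat = i r := fun r => by
        have := Fintype.mem_piFinset.1 hi r
        rw [Finset.mem_range] at this; omega
      simp only [hi', Finset.prod_mul_distrib, Nat.cast_prod]
      ring
    · intro r hr; rw [hn r hr, Nat.min_zero]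
    · intro r hr; rw [hn r hr, Nat.zero_sub]
  · push Not at hn
    obtain ⟨s, hs, hns⟩ := hn
    have hu0 : (u : Module.Dual ℤ N) ∉ perp γ := fun h => hns (by simp [D.apply_p_eq_zero h hs])
    rw [perpChar_of_notMem t hu0, zero_mul]
    refine Finset.sum_eq_zero fun i hi => ?_
    have hi' : i s ≤ ((u : Module.Dual ℤ N) (D.p s)).toNat := by
      have := Fintype.mem_piFinset.1 hi s
      rw [Finset.mem_range] at this; omega
    have hnonneg := D.pair_p_nonneg u s
    -- On `p s` the left and right exponents take the values `i s` and `⟨p s, u⟩ - i s`. Their sum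
    -- is positive, so they are not both in `γ^⊥`.
    by_cases hl : ((D.leftExp u i : S D.σ) : Module.Dual ℤ N) ∈ perp γ
    · have hr : ((D.rightExp u i : S D.σ) : Module.Dual ℤ N) ∉ perp γ := fun hr => by
        have h1 := D.apply_p_eq_zero hl hs
        have h2 := D.apply_p_eq_zero hr hs
        simp [leftExp, D.compat₂] at h1
        simp [rightExp, D.compat₁] at h2
        omega
      rw [perpChar_of_notMem t hr, mul_zero, mul_zero]
    · rw [perpChar_of_notMem t hl, zero_mul, mul_zero]

/-- The idempotents among the points of the orbit `O_γ`. -/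
lemma mul_self_eq_iff :
    D.mul K (torusAct t (distinguishedPoint K hγ)) (torusAct t (distinguishedPoint K hγ)) =
        torusAct t (distinguishedPoint K hγ) ↔
      ∀ u : S D.σ, (u : Module.Dual ℤ N) ∈ perp γ →
        perpChar t γ u * ∏ r, (perpChar t γ (D.e₁ r) + perpChar t γ (D.e₂ r)) ^
          ((u : Module.Dual ℤ N) (D.p r)).toNat = 1 := by
  constructor
  · intro h u hu
    have := mul_self_chi D hγ t u
    rw [h, torusAct_distinguishedPoint_chi] at this
    exact (mul_eq_left₀ (perpChar_ne_zero t hu)).1 this.symm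
  · intro h
    refine Pt.ext_chi fun u => ?_
    rw [mul_self_chi, torusAct_distinguishedPoint_chi]
    by_cases hu : (u : Module.Dual ℤ N) ∈ perp γ
    · rw [h u hu, mul_one]
    · rw [perpChar_of_notMem t hu, zero_mul]

/-- If `E_γ` is not empty and a compatible root is in `γ^⊥`, then the idempotency condition
determines the value of the character at this root. -/
lemma perpChar_root_eq {e : Fin k → Module.Dual ℤ N} (hroot : ∀ r, IsDemazureRoot D.σ (e r))
    (hcompat : ∀ r s, e r (D.p s) = if r = s then -1 else 0) (hγ : IsFace γ D.σ) {c : Fin k → K}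
    (h : ∀ u : S D.σ, (u : Module.Dual ℤ N) ∈ perp γ →
      perpChar t γ u * ∏ r, c r ^ ((u : Module.Dual ℤ N) (D.p r)).toNat = 1)
    {r : Fin k} (hr : latt (D.p r) ∉ γ) (he : e r ∈ perp γ) : perpChar t γ (e r) = c r := by
  classical
  -- A form cutting out `γ` is at least `1` on `p r`, so it has room for one copy of `e r` inside `S
  -- σ`. The condition is compared at `u` and `u + e r`.
  obtain ⟨u, hu, hγu⟩ := hγ
  have huγ : u ∈ perp γ := fun v hv => ((hγu v).1 hv).2
  have hur := D.apply_p_pos hu hγu hr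
  have hsum : ∑ s, (if s = r then 1 else 0 : ℕ) • e s = e r := by simp
  have hw : u + e r ∈ S D.σ := by
    have := D.add_sum_mem hroot hcompat ⟨u, hu⟩ (fun s => if s = r then 1 else 0) fun s => by
      split_ifs with hs
      · subst hs; change 1 ≤ (u (D.p s)).toNat; omega
      · exact Nat.zero_le _
    rwa [hsum] at this
  have hS : ∀ {a : Module.Dual ℤ N}, a ∈ perp γ → a ∈ S γ := fun ha v hv => (ha v hv).ge
  have h1 := h ⟨u, hu⟩ huγ
  have h2 := h ⟨u + e r, hw⟩ ((add_mem_perp_iff (hS huγ) (hS he)).2 ⟨huγ, he⟩)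
  have hprod : ∏ s, c s ^ (u (D.p s)).toNat =
      (∏ s, c s ^ ((u + e r) (D.p s)).toNat) * c r := by
    rw [← Finset.mul_prod_erase _ _ (Finset.mem_univ r),
      ← Finset.mul_prod_erase _ (fun s => c s ^ ((u + e r) (D.p s)).toNat) (Finset.mem_univ r)]
    have h3 : (u (D.p r)).toNat = ((u + e r) (D.p r)).toNat + 1 := by
      simp only [LinearMap.add_apply, hcompat, if_true]; omega
    have h4 : ∀ s ∈ Finset.univ.erase r,
        c s ^ (u (D.p s)).toNat = c s ^ ((u + e r) (D.p s)).toNat := fun s hs => by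
      rw [LinearMap.add_apply, hcompat, if_neg (Finset.ne_of_mem_erase hs).symm, add_zero]
    rw [Finset.prod_congr rfl h4, h3, pow_succ]
    ring
  simp only [perpChar_add t (hS huγ) (hS he)] at h2
  change perpChar t γ u * ∏ s, c s ^ (u (D.p s)).toNat = 1 at h1
  rw [hprod] at h1
  -- With `P` the product at `u + e r`, the two conditions read `c(u) P c_r = 1` and `c(u) c(e r) P
  -- = 1`; cross-multiplying avoids division.
  linear_combination c r * h2 - perpChar t γ (e r) * h1

end RootDatum

end RootMonoid

/-! ### The three claims. -/

open RootMonoid in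
theorem theorem6p1 {K : Type*} [Field K] [IsAlgClosed K] [CharZero K]
    {N : Type*} [AddCommGroup N] [Module.Free ℤ N] [Module.Finite ℤ N] {k : ℕ}
    (D : RootDatum N k) (γ : PointedCone ℚ (NQ N)) (hγ : IsFace γ D.σ) :
    (D.τ ≤ γ → idempotents K D hγ = {distinguishedPoint K hγ}) ∧
    ((∃ r, latt (D.p r) ∉ γ ∧
        ((D.e₁ r ∉ perp γ ∧ D.e₂ r ∉ perp γ) ∨ (D.e₁ r ∈ perp γ ∧ D.e₂ r ∈ perp γ))) →
      idempotents K D hγ = ∅) ∧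
    ((∀ r, latt (D.p r) ∉ γ → Xor (D.e₁ r ∈ perp γ) (D.e₂ r ∈ perp γ)) →
      idempotents K D hγ =
        orbit K hγ ∩
          {x | ∀ u : S D.σ, (u : Module.Dual ℤ N) ∈ perp (D.τ ⊔ γ) → x (chi K u) = 1}) := by
  classical
  refine ⟨fun hτ => ?_, ?_, fun hxor => ?_⟩
  · have hprod : ∀ (c : Fin k → K) (u : S D.σ), (u : Module.Dual ℤ N) ∈ perp γ →
        ∏ r, c r ^ ((u : Module.Dual ℤ N) (D.p r)).toNat = 1 := fun c u hu =>
      Finset.prod_eq_one fun r _ => by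
        have hr : latt (D.p r) ∈ D.τ := by
          have : D.p r ∈ {q | IsRayVector D.τ q} := D.range_p ▸ ⟨r, rfl⟩
          exact IsRayVector.latt_mem this
        rw [D.apply_p_eq_zero hu (hτ hr), Int.toNat_zero, pow_zero]
    ext x
    constructor
    · rintro ⟨⟨t, rfl⟩, h⟩
      have h' := (D.mul_self_eq_iff hγ t).1 h
      refine Pt.ext_chi fun u => ?_
      rw [torusAct_distinguishedPoint_chi, distinguishedPoint_chi]
      split_ifs with hu
      · simpa [hprod _ u hu] using h' u hu
      · exact perpChar_of_notMem t hu
    · rintro rfl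
      have hx : torusAct 1 (distinguishedPoint K hγ) = distinguishedPoint K hγ :=
        Pt.ext_chi fun u => by simp [torusAct_chi]
      refine ⟨⟨1, hx⟩, ?_⟩
      have := (D.mul_self_eq_iff hγ (1 : _ →* Kˣ)).2 fun u hu => by
        rw [hprod _ u hu, perpChar_of_mem _ hu]; simp
      rwa [hx] at this
  · rintro ⟨r, hr, hcase⟩
    refine Set.eq_empty_of_forall_notMem ?_
    rintro _ ⟨⟨t, rfl⟩, h⟩
    have h' := (D.mul_self_eq_iff hγ t).1 h
    rcases hcase with ⟨h₁, h₂⟩ | ⟨h₁, h₂⟩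
    · obtain ⟨u, hu, hγu⟩ := hγ
      have hur := D.apply_p_pos hu hγu hr
      have h3 := h' ⟨u, hu⟩ fun v hv => ((hγu v).1 hv).2
      rw [Finset.prod_eq_zero (Finset.mem_univ r), mul_zero] at h3
      · exact zero_ne_one h3
      · rw [perpChar_of_notMem t h₁, perpChar_of_notMem t h₂, add_zero, zero_pow]
        change (u (D.p r)).toNat ≠ 0
        omega
    -- Here the family `c` is the sum of the two root values, so the value at `e₂ r` is forced to be
    -- zero.
    · have h3 := D.perpChar_root_eq t D.root₁ D.compat₁ hγ h' hr h₁
      exact perpChar_ne_zero t h₂ (by simpa using h3)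
  -- For `p r ∉ γ` this is the root of the pair that lies in `γ^⊥`. For `p r ∈ γ` neither does, and
  -- the default `e₂ r` is immaterial because its exponent will be zero.
  · let e : Fin k → Module.Dual ℤ N := fun r => if D.e₁ r ∈ perp γ then D.e₁ r else D.e₂ r
    have hroot : ∀ r, IsDemazureRoot D.σ (e r) := fun r => by
      simp only [e]; split_ifs
      exacts [D.root₁ r, D.root₂ r]
    have hcompat : ∀ r s, e r (D.p s) = if r = s then -1 else 0 := fun r s => by
      simp only [e]; split_ifs with h h' h'
      all_goals simp [D.compat₁, D.compat₂, h']
    have he : ∀ r, latt (D.p r) ∉ γ → e r ∈ perp γ := fun r hr => by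
      rcases hxor r hr with ⟨h₁, _⟩ | ⟨h₂, h₁⟩
      · simp [e, h₁]
      · simpa only [e, if_neg h₁] using h₂
    have hc : ∀ (t : Multiplicative (Module.Dual ℤ N) →* Kˣ) (r : Fin k), latt (D.p r) ∉ γ →
        perpChar t γ (D.e₁ r) + perpChar t γ (D.e₂ r) = perpChar t γ (e r) := fun t r hr => by
      rcases hxor r hr with ⟨h₁, h₂⟩ | ⟨h₂, h₁⟩
      · simp [e, h₁, perpChar_of_notMem t h₂]
      · simp [e, h₁, perpChar_of_notMem t h₁]
    ext x
    constructor
    · rintro ⟨⟨t, rfl⟩, h⟩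
      refine ⟨⟨t, rfl⟩, fun u hu => ?_⟩
      have hp : ∀ r, (u : Module.Dual ℤ N) (D.p r) = 0 := fun r => by
        have : D.p r ∈ {q | IsRayVector D.τ q} := D.range_p ▸ ⟨r, rfl⟩
        exact D.apply_p_eq_zero hu (le_sup_left (a := D.τ) (IsRayVector.latt_mem this))
      have h1 := (D.mul_self_eq_iff hγ t).1 h u fun v hv => hu v (le_sup_right (a := D.τ) hv)
      rw [torusAct_distinguishedPoint_chi]
      simpa [hp] using h1
    · rintro ⟨⟨t, rfl⟩, h⟩
      refine ⟨⟨t, rfl⟩, (D.mul_self_eq_iff hγ t).2 fun u hu => ?_⟩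
      have hn : ∀ r, latt (D.p r) ∈ γ → ((u : Module.Dual ℤ N) (D.p r)).toNat = 0 :=
        fun r hr => by rw [D.apply_p_eq_zero hu hr, Int.toNat_zero]
      -- Adding `⟨p r, u⟩` copies of `e r` brings the value on each `p r` down to zero without
      -- leaving `S σ` or `γ^⊥`. The value of `x` at `χ^w` is exactly the left side of the criterion
      -- at `u`.
      let w : S D.σ := ⟨_, D.add_sum_mem hroot hcompat u
        (fun r => ((u : Module.Dual ℤ N) (D.p r)).toNat) fun _ => le_rfl⟩
      have hwγ : (w : Module.Dual ℤ N) ∈ perp γ := fun v hv => by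
        change pair (_ + _) v = 0
        rw [pair_add_sum, hu v hv, zero_add]
        refine Finset.sum_eq_zero fun r _ => ?_
        by_cases hr : latt (D.p r) ∈ γ
        · rw [hn r hr, Nat.cast_zero, zero_mul]
        · rw [he r hr v hv, mul_zero]
      have hwτ : (w : Module.Dual ℤ N) ∈ perp D.τ := D.mem_perp_τ fun r => by
        have := D.pair_p_nonneg u r
        simp [w, hcompat, this]
      have hw : (w : Module.Dual ℤ N) ∈ perp (D.τ ⊔ γ) := fun v hv => by
        obtain ⟨a, ha, b, hb, rfl⟩ := Submodule.mem_sup.1 hv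
        rw [map_add, hwτ a ha, hwγ b hb, add_zero]
      have h1 := h w hw
      rw [torusAct_distinguishedPoint_chi,
        D.perpChar_add_sum t hroot hcompat hγ hn fun v hv => u.2 v (hγ.le hv)] at h1
      rw [← h1]
      congr 1
      refine Finset.prod_congr rfl fun r _ => ?_
      by_cases hr : latt (D.p r) ∈ γ
      · rw [hn r hr, pow_zero, pow_zero]
      · rw [hc t r hr]
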